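/- For a norm $s$ on $\mathbb{R}^2$ let $B_s=\{v : s(v)\le 1\}$ be its closed unit ball, let $L_s$ be the Loewner ellipse of $B_s$, i.e. the unique ellipse of largest area contained in $B_s$, and let $|C|$ denote the Lebesgue area of $C\subset\mathbb{R}^2$. The Jacobian of the Hausdorff (Busemann) area $\mu^b$ is $\mathbf{J}^b(s)=\pi/|B_s|$, and the Jacobian of the inscribed Riemannian area $\mu^i$ is $\mathbf{J}^i(s)=\pi/|L_s|$. Then $$q(\mu^b):=\inf_{s}\frac{\mathbf{J}^b(s)}{\mathbf{J}^i(s)}=\frac{\pi}{4},$$ where $s$ runs over all norms on $\mathbb{R}^2$. The infimum is a minimum, and every norm whose unit ball is a Euclidean square attains it. -/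

import Mathlib

open MeasureTheory

namespace NormedPlane

/-- The plane `ℝ²` with its Euclidean structure and Lebesgue measure. -/
abbrev Plane : Type := EuclideanSpace ℝ (Fin 2)

/-- A seminorm on the plane is a norm if it vanishes only at the origin. -/
def IsNorm (s : Seminorm ℝ Plane) : Prop := ∀ v, s v = 0 → v = 0

/-- The closed unit ball `B` of `(ℝ², s)`. -/
def unitBall (s : Seminorm ℝ Plane) : Set Plane := {v | s v ≤ 1}

/-- The Lebesgue area `|C|` of a subset of the plane. -/
noncomputable def area (C : Set Plane) : ℝ := (volume C).toReal

/-- A (filled, non-degenerate) ellipse with an arbitrary centre: the image of the closed Euclidean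
unit disc under an invertible affine map. -/
def IsEllipse (E : Set Plane) : Prop :=
  ∃ (c : Plane) (T : Plane ≃ₗ[ℝ] Plane), E = (fun v => c + T v) '' Metric.closedBall 0 1

/-- `L` is an ellipse of largest area among the ellipses contained in `C`. -/
def IsLoewnerEllipse (C L : Set Plane) : Prop :=
  IsEllipse L ∧ L ⊆ C ∧ ∀ E, IsEllipse E → E ⊆ C → area E ≤ area L

open Classical in
/-- The Loewner ellipse of `C` (every convex body has exactly one; `∅` if there is none). -/
noncomputable def loewnerEllipse (C : Set Plane) : Set Plane :=
  if h : ∃ L, IsLoewnerEllipse C L then h.choose else ∅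

open Classical in
/-- The Jacobian of the Busemann (Hausdorff) area: `π / |B|` on norms, `0` on other seminorms. -/
noncomputable def busemannJacobian (s : Seminorm ℝ Plane) : ℝ :=
  if IsNorm s then Real.pi / area (unitBall s) else 0

open Classical in
/-- The Jacobian of the inscribed Riemannian area: `π / |L|` on norms, where `L` is the Loewner
ellipse of the unit ball, and `0` on other seminorms. -/
noncomputable def inscribedJacobian (s : Seminorm ℝ Plane) : ℝ :=
  if IsNorm s then Real.pi / area (loewnerEllipse (unitBall s)) else 0

/-- The set of all quotients `J(s) / Jⁱ(s)`, where `s` runs over all norms on `ℝ²`. -/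
def jacobianRatios (J : Seminorm ℝ Plane → ℝ) : Set ℝ :=
  {r | ∃ s, IsNorm s ∧ r = J s / inscribedJacobian s}

/-- `q`, the infimum of the quotients `J(s) / Jⁱ(s)` over all norms `s` on `ℝ²`. -/
noncomputable def q (J : Seminorm ℝ Plane → ℝ) : ℝ := sInf (jacobianRatios J)

/-- A (filled, non-degenerate) Euclidean square, in arbitrary position: the image of `[-1, 1]²`
under a similarity. -/
def IsSquareRegion (C : Set Plane) : Prop :=
  ∃ (c : Plane) (r : ℝ) (U : Plane ≃ₗᵢ[ℝ] Plane), 0 < r ∧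
    C = (fun v => c + r • U v) '' {v : Plane | |v 0| ≤ 1 ∧ |v 1| ≤ 1}

end NormedPlane

namespace NormedPlane

/-! The quotient of Jacobians is `|L| / |B|`, which is affinely invariant, so it suffices to show
`|B| ≤ 4` when the unit disc is the largest ellipse in `B` (`IsJohn`). In that position every closed
quarter of the unit circle meets `∂B`, since otherwise the disc could be deformed into a larger
ellipse inside `B` (`IsJohn.exists_contact_near_zero`). At a contact point the tangent of the disc
supports `B`. After a rotation there are contacts at angles `0 ≤ θ ≤ η ≤ π` whose three gaps `θ`, `η
- θ`, `π - η` are at most `π/2`, so `B` lies in a circumscribed hexagon. Its area is twice the sum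
of the tangents of the half gaps, which is at most `4` (`half_angle_sum_le`). Equality for squares
is Hadamard's inequality: the inscribed disc is the largest ellipse in a square
(`abs_det_le_of_maps_square`). -/

/-! ### Coordinates, determinants and areas. -/

theorem mem_ext_iff {v w : Plane} : v = w ↔ v 0 = w 0 ∧ v 1 = w 1 := by
  constructor
  · rintro rfl; simp
  · rintro ⟨h0, h1⟩
    ext i
    fin_cases i <;> assumption

theorem norm_sq_eq (v : Plane) : ‖v‖ ^ 2 = v 0 ^ 2 + v 1 ^ 2 := by
  simp [EuclideanSpace.norm_sq_eq, Fin.sum_univ_two]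

theorem decomp (v : Plane) : v = v 0 • !₂[1, 0] + v 1 • !₂[0, 1] := by
  rw [mem_ext_iff]; simp

theorem det_eq (T : Plane →ₗ[ℝ] Plane) :
    LinearMap.det T = T !₂[1, 0] 0 * T !₂[0, 1] 1 - T !₂[0, 1] 0 * T !₂[1, 0] 1 := by
  have h0 : EuclideanSpace.basisFun (Fin 2) ℝ 0 = !₂[1, 0] := by
    rw [mem_ext_iff]; simp
  have h1 : EuclideanSpace.basisFun (Fin 2) ℝ 1 = !₂[0, 1] := by
    rw [mem_ext_iff]; simp
  rw [← LinearMap.det_toMatrix (EuclideanSpace.basisFun (Fin 2) ℝ).toBasis, Matrix.det_fin_two]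
  simp [LinearMap.toMatrix_apply, h0, h1, -EuclideanSpace.basisFun_apply]

theorem volume_affine_image (c : Plane) (T : Plane →ₗ[ℝ] Plane) (C : Set Plane) :
    volume ((fun v => c + T v) '' C) = ENNReal.ofReal |LinearMap.det T| * volume C := by
  have : (fun v => c + T v) '' C = (fun v => c + v) '' (T '' C) := by
    rw [Set.image_image]
  rw [this, Set.image_add_left, measure_preimage_add, Measure.addHaar_image_linearMap]

theorem area_affine_image (c : Plane) (T : Plane →ₗ[ℝ] Plane) (C : Set Plane) :
    area ((fun v => c + T v) '' C) = |LinearMap.det T| * area C := by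
  rw [area, volume_affine_image, ENNReal.toReal_mul, ENNReal.toReal_ofReal (abs_nonneg _), area]

theorem area_closedBall : area (Metric.closedBall 0 1) = Real.pi := by
  rw [area, EuclideanSpace.volume_closedBall_fin_two]
  simp [Real.pi_nonneg]

theorem area_ellipse (c : Plane) (T : Plane →ₗ[ℝ] Plane) :
    area ((fun v => c + T v) '' Metric.closedBall 0 1) = |LinearMap.det T| * Real.pi := by
  rw [area_affine_image, area_closedBall]

/-- Two maximisers have equal area, so uniqueness of the Loewner ellipse is never needed. -/
theorem IsLoewnerEllipse.area_loewnerEllipse {C L : Set Plane} (h : IsLoewnerEllipse C L) :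
    area (loewnerEllipse C) = area L := by
  have hex : ∃ L, IsLoewnerEllipse C L := ⟨L, h⟩
  rw [loewnerEllipse, dif_pos hex]
  exact le_antisymm (h.2.2 _ hex.choose_spec.1 hex.choose_spec.2.1)
    (hex.choose_spec.2.2 _ h.1 h.2.1)

/-- The quotient of the two Jacobians is the quotient of the areas of the ellipse and the ball. -/
theorem ratio_eq {s : Seminorm ℝ Plane} (hs : IsNorm s) :
    busemannJacobian s / inscribedJacobian s =
      area (loewnerEllipse (unitBall s)) / area (unitBall s) := by
  rw [busemannJacobian, inscribedJacobian, if_pos hs, if_pos hs,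
    div_div_div_cancel_left' _ _ Real.pi_ne_zero]

/-- Area in the coordinate plane `ℝ × ℝ`. -/
theorem volume_eq_prod (C : Set Plane) :
    volume C = volume {p : ℝ × ℝ | (!₂[p.1, p.2] : Plane) ∈ C} := by
  have h1 := (volume_preserving_finTwoArrow ℝ).symm
  have h2 := (PiLp.volume_preserving_toLp (Fin 2))
  have e2 : (WithLp.toLp 2 : (Fin 2 → ℝ) → Plane) = MeasurableEquiv.toLp 2 (Fin 2 → ℝ) := rfl
  rw [e2] at h2
  rw [← h2.measure_preimage_equiv, ← h1.measure_preimage_equiv]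
  rfl

theorem volume_square : volume {v : Plane | |v 0| ≤ 1 ∧ |v 1| ≤ 1} = 4 := by
  rw [volume_eq_prod]
  have : {p : ℝ × ℝ | (!₂[p.1, p.2] : Plane) ∈ {v : Plane | |v 0| ≤ 1 ∧ |v 1| ≤ 1}} =
      Set.Icc (-1) 1 ×ˢ Set.Icc (-1) 1 := by
    ext p
    simp only [Set.mem_ofPred_eq, Set.mem_prod, Set.mem_Icc, abs_le]
    rfl
  rw [this, Measure.volume_eq_prod, Measure.prod_prod, Real.volume_Icc]
  rw [← ENNReal.ofReal_mul (by norm_num)]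
  norm_num

/-! ### The circumscribed hexagon. -/

/-- The hexagon with inner normals `±e₀`, `±(1 - a², 2a)`, `±(c² - 1, 2c)` circumscribed about the
unit disc. -/
def hexagon (a c : ℝ) : Set Plane :=
  {v | |v 0| ≤ 1 ∧ |(1 - a ^ 2) * v 0 + 2 * a * v 1| ≤ 1 + a ^ 2 ∧
    |-(1 - c ^ 2) * v 0 + 2 * c * v 1| ≤ 1 + c ^ 2}

/-- The upper boundary of the hexagon, as a function of the first coordinate. -/
noncomputable def hexagonHeight (a c x : ℝ) : ℝ :=
  min ((1 + a ^ 2 - (1 - a ^ 2) * x) / (2 * a)) ((1 + c ^ 2 + (1 - c ^ 2) * x) / (2 * c))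

theorem continuous_hexagonHeight (a c : ℝ) : Continuous (hexagonHeight a c) := by
  unfold hexagonHeight
  fun_prop

theorem integral_affine (p q u v : ℝ) :
    ∫ x in u..v, (p + q * x) = p * (v - u) + q * ((v ^ 2 - u ^ 2) / 2) := by
  rw [intervalIntegral.integral_add (Continuous.intervalIntegrable (by fun_prop) _ _)
    (Continuous.intervalIntegrable (by fun_prop) _ _),
    intervalIntegral.integral_const_mul, integral_id, intervalIntegral.integral_const]
  simp only [smul_eq_mul]
  ring

/-- With `a`, `c` the tangents of two half gaps, the third is `(1 - a * c) / (a + c)`, and the left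
side is the sum of all three. The claim amounts to `(a + c - 1)² ≤ a * c`, which follows from `|a +
c - 1| ≤ a * c ≤ 1`. -/
theorem half_angle_sum_le {a c : ℝ} (ha0 : 0 < a) (ha : a ≤ 1) (hc0 : 0 < c) (hc : c ≤ 1)
    (h : 1 - a * c ≤ a + c) : (a ^ 2 + c ^ 2 + a * c + 1) / (a + c) ≤ 2 := by
  rw [div_le_iff₀ (by positivity)]
  have h1 : a + c - 1 ≤ a * c := by nlinarith [mul_nonneg (sub_nonneg.2 ha) (sub_nonneg.2 hc)]
  have h2 : a * c ≤ 1 := by nlinarith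
  have h3 : |a + c - 1| ≤ a * c := abs_le.2 ⟨by linarith, h1⟩
  have h4 : (a + c - 1) ^ 2 ≤ (a * c) ^ 2 := sq_le_sq' (by linarith) h1
  nlinarith [mul_pos ha0 hc0]

theorem integral_hexagonHeight_le {a c : ℝ} (ha0 : 0 < a) (ha : a ≤ 1) (hc0 : 0 < c) (hc : c ≤ 1)
    (h : 1 - a * c ≤ a + c) : ∫ x in (-1 : ℝ)..1, hexagonHeight a c x ≤ 2 := by
  -- The abscissa of the vertex where the two upper sides meet; bounding the minimum by one side on
  -- each half loses nothing.
  set t := (c - a) / (a + c) with ht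
  have hac : 0 < a + c := by positivity
  have ht1 : t ≤ 1 := by rw [ht, div_le_one hac]; linarith
  have ht2 : -1 ≤ t := by rw [ht, le_div_iff₀ hac]; linarith
  have hint := fun u v => (continuous_hexagonHeight a c).intervalIntegrable (μ := volume) u v
  rw [← intervalIntegral.integral_add_adjacent_intervals (hint (-1) t) (hint t 1)]
  have h1 : ∫ x in (-1 : ℝ)..t, hexagonHeight a c x ≤
      ∫ x in (-1 : ℝ)..t, ((1 + c ^ 2) / (2 * c) + (1 - c ^ 2) / (2 * c) * x) := by
    refine intervalIntegral.integral_mono_on ht2 (hint _ _)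
      (Continuous.intervalIntegrable (by fun_prop) _ _) fun x _ => (min_le_right _ _).trans_eq ?_
    ring
  have h2 : ∫ x in t..1, hexagonHeight a c x ≤
      ∫ x in t..1, ((1 + a ^ 2) / (2 * a) + (-(1 - a ^ 2) / (2 * a)) * x) := by
    refine intervalIntegral.integral_mono_on ht1 (hint _ _)
      (Continuous.intervalIntegrable (by fun_prop) _ _) fun x _ => (min_le_left _ _).trans_eq ?_
    ring
  rw [integral_affine] at h1 h2
  refine (add_le_add h1 h2).trans (le_trans (le_of_eq ?_) (half_angle_sum_le ha0 ha hc0 hc h))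
  rw [ht]
  field_simp
  ring

theorem volume_hexagon_le {a c : ℝ} (ha0 : 0 ≤ a) (ha : a ≤ 1) (hc0 : 0 ≤ c) (hc : c ≤ 1)
    (h : 1 - a * c ≤ a + c) : volume (hexagon a c) ≤ 4 := by
  -- `hexagonHeight` divides by `a` and `c`; if one vanishes, the other is `1` and the hexagon lies
  -- in the square.
  rcases ha0.eq_or_lt with rfl | ha0
  · obtain rfl : c = 1 := by linarith
    rw [← volume_square]
    refine measure_mono fun v hv => ⟨hv.1, ?_⟩
    have := hv.2.2
    rw [abs_le] at this ⊢
    constructor <;> linarith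
  rcases hc0.eq_or_lt with rfl | hc0
  · obtain rfl : a = 1 := by linarith
    rw [← volume_square]
    refine measure_mono fun v hv => ⟨hv.1, ?_⟩
    have := hv.2.1
    rw [abs_le] at this ⊢
    constructor <;> linarith
  have hcont := continuous_hexagonHeight a c
  -- By central symmetry the lower boundary is `x ↦ -hexagonHeight a c (-x)`.
  have hsub : {p : ℝ × ℝ | (!₂[p.1, p.2] : Plane) ∈ hexagon a c} ⊆
      {p : ℝ × ℝ | p.1 ∈ Set.Icc (-1) 1 ∧
        p.2 ∈ Set.Icc (-hexagonHeight a c (-p.1)) (hexagonHeight a c p.1)} := by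
    rintro ⟨x, y⟩ ⟨h1, h2, h3⟩
    simp only [abs_le, Matrix.cons_val_zero, Matrix.cons_val_one] at h1 h2 h3
    refine ⟨h1, ?_, ?_⟩
    · rw [neg_le]
      refine le_min ?_ ?_ <;> rw [le_div_iff₀ (by positivity)] <;> dsimp only <;> linarith
    · refine le_min ?_ ?_ <;> rw [le_div_iff₀ (by positivity)] <;> dsimp only <;> linarith
  have hint := fun u v => hcont.intervalIntegrable (μ := volume) u v
  have hcont' : Continuous fun x => hexagonHeight a c (-x) := hcont.comp continuous_neg
  rw [volume_eq_prod]
  refine (measure_mono hsub).trans ?_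
  have hmeas : MeasurableSet {p : ℝ × ℝ | p.1 ∈ Set.Icc (-1 : ℝ) 1 ∧
        p.2 ∈ Set.Icc (-hexagonHeight a c (-p.1)) (hexagonHeight a c p.1)} := by
    refine IsClosed.measurableSet ?_
    refine (isClosed_Icc.preimage continuous_fst).inter (IsClosed.inter ?_ ?_)
    · exact isClosed_le (hcont'.comp continuous_fst).neg continuous_snd
    · exact isClosed_le continuous_snd (hcont.comp continuous_fst)
  -- Nonnegative slice lengths keep `ENNReal.ofReal` from truncating, so the area is a real
  -- integral.
  have hnn : ∀ x ∈ Set.Icc (-1 : ℝ) 1, 0 ≤ hexagonHeight a c x + hexagonHeight a c (-x) := by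
    have key : ∀ x ∈ Set.Icc (-1 : ℝ) 1, 0 ≤ hexagonHeight a c x := by
      rintro x ⟨hx1, hx2⟩
      refine le_min (div_nonneg ?_ (by positivity)) (div_nonneg ?_ (by positivity)) <;>
        nlinarith [mul_nonneg (sub_nonneg.2 hx2) (sub_nonneg.2 hx1), sq_nonneg a, sq_nonneg c,
          mul_nonneg ha0.le (sub_nonneg.2 ha), mul_nonneg hc0.le (sub_nonneg.2 hc),
          mul_nonneg (sq_nonneg a) (sub_nonneg.2 hx1), mul_nonneg (sq_nonneg a) (sub_nonneg.2 hx2),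
          mul_nonneg (sq_nonneg c) (sub_nonneg.2 hx1), mul_nonneg (sq_nonneg c) (sub_nonneg.2 hx2)]
    intro x hx
    exact add_nonneg (key x hx) (key _ ⟨by linarith [hx.2], by linarith [hx.1]⟩)
  rw [Measure.volume_eq_prod, Measure.prod_apply hmeas]
  calc ∫⁻ x, volume (Prod.mk x ⁻¹' {p : ℝ × ℝ | p.1 ∈ Set.Icc (-1 : ℝ) 1 ∧
        p.2 ∈ Set.Icc (-hexagonHeight a c (-p.1)) (hexagonHeight a c p.1)})
      = ∫⁻ x in Set.Icc (-1 : ℝ) 1,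
          ENNReal.ofReal (hexagonHeight a c x + hexagonHeight a c (-x)) := by
        rw [← lintegral_indicator measurableSet_Icc]
        refine lintegral_congr fun x => ?_
        by_cases hx : x ∈ Set.Icc (-1 : ℝ) 1
        · have : Prod.mk x ⁻¹' {p : ℝ × ℝ | p.1 ∈ Set.Icc (-1 : ℝ) 1 ∧
              p.2 ∈ Set.Icc (-hexagonHeight a c (-p.1)) (hexagonHeight a c p.1)} =
              Set.Icc (-hexagonHeight a c (-x)) (hexagonHeight a c x) := by
            ext y
            exact and_iff_right hx
          rw [this, Real.volume_Icc, Set.indicator_of_mem hx, sub_neg_eq_add]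
        · have : Prod.mk x ⁻¹' {p : ℝ × ℝ | p.1 ∈ Set.Icc (-1 : ℝ) 1 ∧
              p.2 ∈ Set.Icc (-hexagonHeight a c (-p.1)) (hexagonHeight a c p.1)} = ∅ := by
            ext y
            exact iff_of_false (fun hy => hx hy.1) (Set.notMem_empty y)
          rw [this, measure_empty, Set.indicator_of_notMem hx]
    _ = ENNReal.ofReal (∫ x in (-1 : ℝ)..1, (hexagonHeight a c x + hexagonHeight a c (-x))) := by
        rw [intervalIntegral.integral_of_le (by norm_num), ← integral_Icc_eq_integral_Ioc,
          ofReal_integral_eq_lintegral_ofReal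
            (f := fun x => hexagonHeight a c x + hexagonHeight a c (-x))
            ((hcont.add hcont').continuousOn.integrableOn_compact isCompact_Icc)
            (ae_restrict_of_forall_mem measurableSet_Icc hnn)]
    _ ≤ 4 := by
        have hle := integral_hexagonHeight_le ha0 ha hc0 hc h
        rw [intervalIntegral.integral_add (hint _ _) (hcont'.intervalIntegrable _ _),
          intervalIntegral.integral_comp_neg, neg_neg]
        refine (ENNReal.ofReal_le_ofReal (add_le_add hle hle)).trans ?_
        norm_num

/-! ### Squares and the supremum norm. -/

/-- Testing on the normalised rows of `T` shows that each row has norm at most `1`; Hadamard's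
inequality does the rest. -/
theorem abs_det_le_of_maps_square {c : Plane} {T : Plane →ₗ[ℝ] Plane}
    (h : ∀ v : Plane, ‖v‖ ≤ 1 → |(c + T v) 0| ≤ 1 ∧ |(c + T v) 1| ≤ 1) :
    |LinearMap.det T| ≤ 1 := by
  have row : ∀ i : Fin 2, (∀ v : Plane, ‖v‖ ≤ 1 → |(c + T v) i| ≤ 1) →
      T !₂[1, 0] i ^ 2 + T !₂[0, 1] i ^ 2 ≤ 1 := by
    intro i hi
    set w : Plane := !₂[T !₂[1, 0] i, T !₂[0, 1] i] with hw
    have hw2 : ‖w‖ ^ 2 = T !₂[1, 0] i ^ 2 + T !₂[0, 1] i ^ 2 := by simp [norm_sq_eq, hw]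
    rw [← hw2]
    rcases eq_or_ne w 0 with h0 | h0
    · simp [h0]
    have hpos : 0 < ‖w‖ := norm_pos_iff.2 h0
    have hTw : T w i = ‖w‖ ^ 2 := by
      rw [decomp w, map_add, map_smul, map_smul, ← decomp w, hw2]
      simp [hw]
      ring
    have hn : ‖(‖w‖⁻¹ • w)‖ ≤ 1 := by
      rw [norm_smul, norm_inv, norm_norm, inv_mul_cancel₀ hpos.ne']
    have hval : T (‖w‖⁻¹ • w) i = ‖w‖ := by
      rw [map_smul, PiLp.smul_apply, hTw, smul_eq_mul]
      field_simp
    have h1 := hi _ hn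
    -- Antipodal points eliminate the centre `c`.
    have h2 := hi (-(‖w‖⁻¹ • w)) (by rwa [norm_neg])
    rw [map_neg, PiLp.add_apply, PiLp.neg_apply, hval, abs_le] at h2
    rw [PiLp.add_apply, hval, abs_le] at h1
    nlinarith
  have h0 := row 0 fun v hv => (h v hv).1
  have h1 := row 1 fun v hv => (h v hv).2
  rw [det_eq, abs_le]
  constructor <;> nlinarith [sq_nonneg (T !₂[1, 0] 0 - T !₂[0, 1] 1),
    sq_nonneg (T !₂[1, 0] 0 + T !₂[0, 1] 1), sq_nonneg (T !₂[0, 1] 0 - T !₂[1, 0] 1),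
    sq_nonneg (T !₂[0, 1] 0 + T !₂[1, 0] 1)]

theorem IsSquareRegion.ratio {C : Set Plane} (h : IsSquareRegion C) :
    area (loewnerEllipse C) / area C = Real.pi / 4 := by
  obtain ⟨c, r, U, hr, rfl⟩ := h
  let S : Plane ≃ₗ[ℝ] Plane := U.toLinearEquiv.trans (LinearEquiv.smulOfNeZero ℝ Plane r hr.ne')
  have hS : ∀ v, S v = r • U v := fun v => rfl
  have hdet : 0 < |LinearMap.det (S : Plane →ₗ[ℝ] Plane)| :=
    abs_pos.2 (LinearEquiv.isUnit_det' S).ne_zero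
  have hfun : (fun v => c + r • U v) = fun v => c + (S : Plane →ₗ[ℝ] Plane) v := rfl
  have hL : IsLoewnerEllipse ((fun v => c + r • U v) '' {v : Plane | |v 0| ≤ 1 ∧ |v 1| ≤ 1})
      ((fun v => c + S v) '' Metric.closedBall 0 1) := by
    refine ⟨⟨c, S, rfl⟩, ?_, ?_⟩
    · refine Set.image_mono fun v hv => ?_
      rw [mem_closedBall_zero_iff] at hv
      have := norm_sq_eq v
      constructor <;> refine abs_le_one_iff_mul_self_le_one.2 ?_ <;>
        nlinarith [norm_nonneg v, sq_nonneg (v 0), sq_nonneg (v 1)]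
    · rintro E ⟨c', T, rfl⟩ hE
      have h1 := area_ellipse c' (T : Plane →ₗ[ℝ] Plane)
      have h2 := area_ellipse c (S : Plane →ₗ[ℝ] Plane)
      simp only [LinearEquiv.coe_coe] at h1 h2
      rw [h1, h2]
      refine mul_le_mul_of_nonneg_right ?_ Real.pi_nonneg
      have h3 : |LinearMap.det ((S.symm : Plane →ₗ[ℝ] Plane) ∘ₗ (T : Plane →ₗ[ℝ] Plane))| ≤ 1 := by
        refine abs_det_le_of_maps_square (c := S.symm (c' - c)) fun v hv => ?_
        obtain ⟨w, hw, hwe⟩ := hE ⟨v, mem_closedBall_zero_iff.2 hv, rfl⟩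
        have : S.symm (c' - c) + S.symm (T v) = w := by
          rw [← map_add, LinearEquiv.symm_apply_eq, hS]
          have hwe' : c + r • U w = c' + T v := hwe
          rw [sub_add_eq_add_sub, ← hwe', add_sub_cancel_left]
        simp only [LinearMap.comp_apply, LinearEquiv.coe_coe, this]
        exact hw
      have h4 : (T : Plane →ₗ[ℝ] Plane) = (S : Plane →ₗ[ℝ] Plane) ∘ₗ
          ((S.symm : Plane →ₗ[ℝ] Plane) ∘ₗ (T : Plane →ₗ[ℝ] Plane)) := by
        ext v
        simp
      rw [h4, LinearMap.det_comp, abs_mul]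
      exact mul_le_of_le_one_right (abs_nonneg _) h3
  have h2 := area_ellipse c (S : Plane →ₗ[ℝ] Plane)
  simp only [LinearEquiv.coe_coe] at h2
  rw [hL.area_loewnerEllipse, h2, hfun, area_affine_image, mul_div_mul_left _ _ hdet.ne',
    area, volume_square]
  norm_num

/-- The supremum norm on the plane. -/
noncomputable def supNorm : Seminorm ℝ Plane :=
  (normSeminorm ℝ ℝ).comp (EuclideanSpace.proj (𝕜 := ℝ) (0 : Fin 2)).toLinearMap ⊔
    (normSeminorm ℝ ℝ).comp (EuclideanSpace.proj (𝕜 := ℝ) (1 : Fin 2)).toLinearMap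

theorem supNorm_apply (v : Plane) : supNorm v = max |v 0| |v 1| := rfl

theorem isNorm_supNorm : IsNorm supNorm := by
  intro v hv
  rw [supNorm_apply] at hv
  have h0 := (le_max_left |v 0| |v 1|).trans_eq hv
  have h1 := (le_max_right |v 0| |v 1|).trans_eq hv
  rw [abs_nonpos_iff] at h0 h1
  exact mem_ext_iff.2 ⟨h0, h1⟩

theorem isSquareRegion_unitBall_supNorm : IsSquareRegion (unitBall supNorm) := by
  refine ⟨0, 1, LinearIsometryEquiv.refl ℝ Plane, one_pos, ?_⟩
  ext v
  simp [unitBall, supNorm_apply]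

/-! ### Rotations and unit directions. -/

/-- The linear map with matrix `!![p, q; r, t]`. -/
noncomputable def linMap (p q r t : ℝ) : Plane →ₗ[ℝ] Plane where
  toFun v := !₂[p * v 0 + q * v 1, r * v 0 + t * v 1]
  map_add' v w := by rw [mem_ext_iff]; simp; constructor <;> ring
  map_smul' k v := by rw [mem_ext_iff]; simp; constructor <;> ring

theorem linMap_apply (p q r t : ℝ) (v : Plane) :
    linMap p q r t v = !₂[p * v 0 + q * v 1, r * v 0 + t * v 1] := rfl

theorem det_linMap (p q r t : ℝ) : LinearMap.det (linMap p q r t) = p * t - q * r := by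
  rw [det_eq]; simp [linMap_apply]

/-- The unit vector of angle `φ`. -/
noncomputable def dir (φ : ℝ) : Plane := !₂[Real.cos φ, Real.sin φ]

@[simp] theorem dir_zero_coord (φ : ℝ) : dir φ 0 = Real.cos φ := rfl

@[simp] theorem dir_one_coord (φ : ℝ) : dir φ 1 = Real.sin φ := rfl

theorem norm_dir (φ : ℝ) : ‖dir φ‖ = 1 := by
  have h := norm_sq_eq (dir φ)
  simp only [dir_zero_coord, dir_one_coord, Real.cos_sq_add_sin_sq] at h
  exact (pow_eq_one_iff_of_nonneg (norm_nonneg _) two_ne_zero).1 h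

theorem continuous_dir : Continuous dir := by
  refine (PiLp.continuous_toLp 2 _).comp (continuous_pi fun i => ?_)
  fin_cases i
  · exact Real.continuous_cos
  · exact Real.continuous_sin

/-- The rotation of angle `φ`. -/
noncomputable def rot (φ : ℝ) : Plane →ₗ[ℝ] Plane :=
  linMap (Real.cos φ) (-Real.sin φ) (Real.sin φ) (Real.cos φ)

theorem det_rot (φ : ℝ) : LinearMap.det (rot φ) = 1 := by
  rw [rot, det_linMap]
  linarith [Real.cos_sq_add_sin_sq φ]

theorem rot_dir (φ ψ : ℝ) : rot φ (dir ψ) = dir (φ + ψ) := by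
  rw [mem_ext_iff]
  simp only [rot, linMap_apply, dir_zero_coord, dir_one_coord, Real.cos_add, Real.sin_add]
  constructor
  · simp; ring
  · simp

theorem norm_rot (φ : ℝ) (v : Plane) : ‖rot φ v‖ = ‖v‖ := by
  refine (sq_eq_sq₀ (norm_nonneg _) (norm_nonneg _)).1 ?_
  rw [norm_sq_eq, norm_sq_eq]
  simp only [rot, linMap_apply, PiLp.toLp_apply, Matrix.cons_val_zero, Matrix.cons_val_one]
  linear_combination (v 0 ^ 2 + v 1 ^ 2) * Real.cos_sq_add_sin_sq φ

/-! ### John position and contact points. -/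

/-- The Euclidean unit disc has maximal area among the centred ellipses in the unit ball of `s`. -/
def IsJohn (s : Seminorm ℝ Plane) : Prop :=
  (∀ v, s v ≤ ‖v‖) ∧
    ∀ S : Plane →ₗ[ℝ] Plane, (∀ v, s (S v) ≤ ‖v‖) → |LinearMap.det S| ≤ 1

theorem IsJohn.comp_rot {s : Seminorm ℝ Plane} (hs : IsJohn s) (φ : ℝ) :
    IsJohn (s.comp (rot φ)) := by
  refine ⟨fun v => (hs.1 _).trans_eq (norm_rot φ v), fun S hS => ?_⟩
  have := hs.2 (rot φ ∘ₗ S) hS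
  rwa [LinearMap.det_comp, det_rot, one_mul] at this

theorem seminorm_continuous (s : Seminorm ℝ Plane) : Continuous s :=
  continuousOn_univ.1 (s.convexOn.continuousOn isOpen_univ)

theorem exists_smul_dir {v : Plane} (h0 : 0 < v 0) (h : |v 1| ≤ v 0) :
    ∃ ψ ∈ Set.Icc (-(Real.pi / 4)) (Real.pi / 4), v = ‖v‖ • dir ψ := by
  set ψ := Real.arctan (v 1 / v 0) with hψ
  have habs := abs_le.1 h
  have hsq : 0 < √(1 + (v 1 / v 0) ^ 2) := Real.sqrt_pos.2 (by positivity)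
  have hv : v = (v 0 * √(1 + (v 1 / v 0) ^ 2)) • dir ψ := by
    rw [mem_ext_iff]
    simp only [PiLp.smul_apply, dir_zero_coord, dir_one_coord, hψ, Real.cos_arctan,
      Real.sin_arctan, smul_eq_mul]
    constructor <;> field_simp
  refine ⟨ψ, ⟨?_, ?_⟩, ?_⟩
  · rw [← Real.arctan_one, ← Real.arctan_neg]
    refine Real.arctan_strictMono.monotone ?_
    rw [le_div_iff₀ h0]; linarith
  · rw [← Real.arctan_one]
    refine Real.arctan_strictMono.monotone ?_
    rw [div_le_iff₀ h0]; linarith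
  · have hn : ‖v‖ = v 0 * √(1 + (v 1 / v 0) ^ 2) := by
      conv_lhs => rw [hv]
      rw [norm_smul, norm_dir, mul_one, Real.norm_of_nonneg (by positivity)]
    rw [hn]
    exact hv

/-- Without a contact, compactness gives `s ≤ k‖·‖` with `k < 1` on the cone `|v 1| ≤ |v 0|`. The
disc can then be stretched along the first axis and shrunk along the second, with a net gain of
area. -/
theorem IsJohn.exists_contact_near_zero {s : Seminorm ℝ Plane} (hs : IsJohn s) :
    ∃ ψ ∈ Set.Icc (-(Real.pi / 4)) (Real.pi / 4), s (dir ψ) = 1 := by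
  by_contra! hcon
  have hpi := Real.pi_pos
  obtain ⟨ψ₀, hψ₀, hmax⟩ := (isCompact_Icc (a := -(Real.pi / 4)) (b := Real.pi / 4)).exists_isMaxOn
    ⟨0, by constructor <;> linarith⟩ ((seminorm_continuous s).comp continuous_dir).continuousOn
  have hlt : s (dir ψ₀) < 1 := lt_of_le_of_ne ((hs.1 _).trans_eq (norm_dir _)) (hcon _ hψ₀)
  set k := max (s (dir ψ₀)) (1 / 2) with hk
  have hk0 : 0 < k := lt_max_of_lt_right (by norm_num)
  have hk1 : k < 1 := max_lt hlt (by norm_num)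
  have hkk : k ^ 2 < 1 := by nlinarith
  have pos_case : ∀ v : Plane, 0 < v 0 → |v 1| ≤ v 0 → s v ≤ k * ‖v‖ := by
    intro v h0 h
    obtain ⟨ψ, hψ, hv⟩ := exists_smul_dir h0 h
    have h1 : s v = ‖v‖ * s (dir ψ) := by
      conv_lhs => rw [hv]
      rw [map_smul_eq_mul, norm_norm]
    rw [h1, mul_comm]
    exact mul_le_mul_of_nonneg_right ((hmax hψ).trans (le_max_left _ _)) (norm_nonneg _)
  have cone : ∀ v : Plane, |v 1| ≤ |v 0| → s v ≤ k * ‖v‖ := by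
    intro v h
    rcases lt_trichotomy (v 0) 0 with h0 | h0 | h0
    · have := pos_case (-v) (by simpa using h0) (by
        rwa [PiLp.neg_apply, PiLp.neg_apply, abs_neg, ← abs_of_neg h0])
      rwa [map_neg_eq_map, norm_neg] at this
    · have hv : v = 0 := mem_ext_iff.2 ⟨h0, by simpa [h0] using h⟩
      simp [hv]
    · exact pos_case v h0 (by rwa [abs_of_pos h0] at h)
  -- With this `b` the ellipse `k²x² + b²y² = 1` crosses the unit circle on the diagonals `|x| =
  -- |y|`: it leaves the disc only inside the cone. Its area exceeds `π` because `k²b² = 1 - (1 -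
  -- k²)²`.
  set b := √(2 - k ^ 2) with hb
  have hb0 : 0 < b := Real.sqrt_pos.2 (by linarith)
  have hb2 : b ^ 2 = 2 - k ^ 2 := Real.sq_sqrt (by linarith)
  have hdet := hs.2 (linMap k⁻¹ 0 0 b⁻¹) fun v => by
    set w := linMap k⁻¹ 0 0 b⁻¹ v with hw
    have h0 : v 0 = k * w 0 := by simp [hw, linMap_apply]; field_simp
    have h1 : v 1 = b * w 1 := by simp [hw, linMap_apply]; field_simp
    have hv := norm_sq_eq v
    have hwn := norm_sq_eq w
    rw [h0, h1, mul_pow, mul_pow, hb2] at hv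
    rcases le_total |w 1| |w 0| with h | h
    · refine (cone w h).trans (abs_le_of_sq_le_sq' ?_ (norm_nonneg _)).2
      rw [mul_pow, hwn, hv]
      nlinarith [sq_nonneg (w 1)]
    · refine (hs.1 w).trans (abs_le_of_sq_le_sq' ?_ (norm_nonneg _)).2
      rw [hwn, hv]
      nlinarith [sq_le_sq.2 h]
  rw [det_linMap, zero_mul, sub_zero, ← mul_inv, abs_of_pos (by positivity),
    inv_le_one₀ (by positivity)] at hdet
  have : (k * b) ^ 2 < 1 := by
    rw [mul_pow, hb2]
    nlinarith [sq_pos_of_pos (sub_pos.2 hkk)]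
  nlinarith

theorem IsJohn.exists_contact {s : Seminorm ℝ Plane} (hs : IsJohn s) (φ : ℝ) :
    ∃ ψ ∈ Set.Icc φ (φ + Real.pi / 2), s (dir ψ) = 1 := by
  obtain ⟨ψ, hψ, h⟩ := (hs.comp_rot (φ + Real.pi / 4)).exists_contact_near_zero
  rw [Seminorm.comp_apply, rot_dir] at h
  exact ⟨_, ⟨by linarith [hψ.1], by linarith [hψ.2]⟩, h⟩

/-- At a common boundary point of the disc and the ball, the tangent of the disc supports the
ball. -/
theorem inner_le_of_contact {s : Seminorm ℝ Plane} (hs : ∀ v, s v ≤ ‖v‖) {u : Plane}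
    (hu : ‖u‖ = 1) (hsu : s u = 1) (v : Plane) : v 0 * u 0 + v 1 * u 1 ≤ s v := by
  refine le_of_forall_pos_le_add fun ε hε => ?_
  -- Perturb `u` to `u - t • v` and compare first-order terms in `t`; this `t` keeps the quadratic
  -- remainder below `ε`.
  set t := ε / (‖v‖ ^ 2 + 1) with ht
  have htpos : 0 < t := by positivity
  have htε : t * ‖v‖ ^ 2 ≤ ε := by
    rw [ht, div_mul_eq_mul_div, div_le_iff₀ (by positivity)]
    nlinarith
  have h1 : 1 ≤ ‖u - t • v‖ + t * s v := by
    calc (1 : ℝ) = s ((u - t • v) + t • v) := by rw [sub_add_cancel, hsu]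
      _ ≤ s (u - t • v) + s (t • v) := map_add_le_add s _ _
      _ ≤ ‖u - t • v‖ + t * s v := by
        rw [map_smul_eq_mul, Real.norm_of_nonneg htpos.le]
        linarith [hs (u - t • v)]
  have h2 := norm_sq_eq (u - t • v)
  have h3 := norm_sq_eq u
  have h4 := norm_sq_eq v
  simp only [PiLp.sub_apply, PiLp.smul_apply, smul_eq_mul] at h2
  have h5 : 2 * ‖u - t • v‖ ≤ ‖u - t • v‖ ^ 2 + 1 := by nlinarith [sq_nonneg (‖u - t • v‖ - 1)]
  have h6 : t * (2 * (v 0 * u 0 + v 1 * u 1)) ≤ t * (2 * s v + ε) := by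
    have h7 := mul_le_mul_of_nonneg_left htε htpos.le
    rw [hu] at h3
    rw [h4] at h7
    linarith
  have := le_of_mul_le_mul_left h6 htpos
  linarith

theorem abs_inner_le_of_contact {s : Seminorm ℝ Plane} (hs : ∀ v, s v ≤ ‖v‖) {ψ : ℝ}
    (h : s (dir ψ) = 1) (v : Plane) : |v 0 * Real.cos ψ + v 1 * Real.sin ψ| ≤ s v := by
  have h1 := inner_le_of_contact hs (norm_dir ψ) h v
  have h2 := inner_le_of_contact hs (norm_dir ψ) h (-v)
  rw [map_neg_eq_map] at h2
  simp only [PiLp.neg_apply, dir_zero_coord, dir_one_coord] at h1 h2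
  rw [abs_le]
  constructor <;> linarith

/-- The contact angles in `[0, π]` can be thinned out to three consecutive gaps of at most
`π / 2`. -/
theorem IsJohn.exists_contact_angles {s : Seminorm ℝ Plane} (hs : IsJohn s)
    (h0 : s (dir 0) = 1) :
    ∃ θ ∈ Set.Icc 0 (Real.pi / 2), ∃ η ∈ Set.Icc (Real.pi / 2) Real.pi,
      s (dir θ) = 1 ∧ s (dir η) = 1 ∧ η - θ ≤ Real.pi / 2 := by
  have hpi := Real.pi_pos
  have hclosed : IsClosed {ψ : ℝ | s (dir ψ) = 1} :=
    isClosed_eq ((seminorm_continuous s).comp continuous_dir) continuous_const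
  have hpi1 : s (dir Real.pi) = 1 := by
    have : dir Real.pi = -dir 0 := by rw [mem_ext_iff]; simp
    rw [this, map_neg_eq_map, h0]
  obtain ⟨θ, ⟨hθ, hsθ⟩, hθmax⟩ := ((isCompact_Icc (a := 0) (b := Real.pi / 2)).inter_right
    hclosed).exists_isGreatest ⟨0, ⟨le_rfl, by linarith⟩, h0⟩
  obtain ⟨η, ⟨hη, hsη⟩, hηmin⟩ := ((isCompact_Icc (a := Real.pi / 2) (b := Real.pi)).inter_right
    hclosed).exists_isLeast ⟨Real.pi, ⟨by linarith, le_rfl⟩, hpi1⟩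
  refine ⟨θ, hθ, η, hη, hsθ, hsη, ?_⟩
  by_contra! hgap
  -- The quarter arc centred in a gap longer than `π/2` lies strictly inside it, so its contact
  -- contradicts the choice of `θ` or `η`.
  obtain ⟨ψ, hψ, hsψ⟩ := hs.exists_contact ((θ + η - Real.pi / 2) / 2)
  have h1 := hψ.1
  have h2 := hψ.2
  rcases le_total ψ (Real.pi / 2) with h | h
  · have := hθmax ⟨⟨by linarith [hθ.1], h⟩, hsψ⟩
    linarith
  · have := hηmin ⟨⟨h, by linarith [hη.2]⟩, hsψ⟩
    linarith

/-! ### The area bound in John position. -/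

theorem tan_half_mul_cos {x : ℝ} (hx : Real.cos (x / 2) ≠ 0) :
    (1 + Real.tan (x / 2) ^ 2) * Real.cos x = 1 - Real.tan (x / 2) ^ 2 ∧
      (1 + Real.tan (x / 2) ^ 2) * Real.sin x = 2 * Real.tan (x / 2) := by
  have h1 : Real.cos x = 2 * Real.cos (x / 2) ^ 2 - 1 := by rw [← Real.cos_two_mul]; ring_nf
  have h2 : Real.sin x = 2 * Real.sin (x / 2) * Real.cos (x / 2) := by
    rw [← Real.sin_two_mul]; ring_nf
  have h3 := Real.cos_sq_add_sin_sq (x / 2)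
  rw [h1, h2, Real.tan_eq_sin_div_cos]
  constructor
  · field_simp
    linear_combination (2 * Real.cos (x / 2) ^ 2) * h3
  · field_simp
    linear_combination Real.sin (x / 2) * h3

/-- The supporting tangents at the contact angles `0`, `θ`, `π - γ` enclose the ball in `hexagon a
c` with `a = tan (θ/2)`, `c = tan (γ/2)`. -/
theorem IsJohn.volume_unitBall_le_of_contact {s : Seminorm ℝ Plane} (hs : IsJohn s)
    (h0 : s (dir 0) = 1) : volume (unitBall s) ≤ 4 := by
  have hpi := Real.pi_pos
  obtain ⟨θ, hθ, η, hη, hsθ, hsη, hgap⟩ := hs.exists_contact_angles h0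
  obtain ⟨γ, rfl⟩ : ∃ γ, η = Real.pi - γ := ⟨Real.pi - η, by ring⟩
  have hγ : γ ∈ Set.Icc 0 (Real.pi / 2) := ⟨by linarith [hη.2], by linarith [hη.1]⟩
  have cos_pos : ∀ x ∈ Set.Icc 0 (Real.pi / 2), 0 < Real.cos (x / 2) := fun x hx =>
    Real.cos_pos_of_mem_Ioo ⟨by linarith [hx.1], by linarith [hx.2]⟩
  have tan_nonneg : ∀ x ∈ Set.Icc 0 (Real.pi / 2), 0 ≤ Real.tan (x / 2) := fun x hx =>
    Real.tan_nonneg_of_nonneg_of_le_pi_div_two (by linarith [hx.1]) (by linarith [hx.2])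
  have tan_le : ∀ x ∈ Set.Icc 0 (Real.pi / 2), Real.tan (x / 2) ≤ 1 := fun x hx => by
    rw [← Real.tan_pi_div_four]
    exact Real.strictMonoOn_tan.monotoneOn ⟨by linarith [hx.1], by linarith [hx.2]⟩
      ⟨by linarith, by linarith⟩ (by linarith [hx.2])
  refine (measure_mono ?_).trans (volume_hexagon_le (tan_nonneg θ hθ) (tan_le θ hθ)
    (tan_nonneg γ hγ) (tan_le γ hγ) ?_)
  · intro v hv
    have hv' : s v ≤ 1 := hv
    have scale : ∀ x y t : ℝ, |y| ≤ s v → (1 + t ^ 2) * y = x → |x| ≤ 1 + t ^ 2 := by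
      rintro x y t hy rfl
      rw [abs_mul, abs_of_pos (by positivity)]
      exact mul_le_of_le_one_right (by positivity) (hy.trans hv')
    refine ⟨?_, scale _ _ _ (abs_inner_le_of_contact hs.1 hsθ v) ?_,
      scale _ _ _ (abs_inner_le_of_contact hs.1 hsη v) ?_⟩
    · have := abs_inner_le_of_contact hs.1 h0 v
      simp only [Real.cos_zero, Real.sin_zero, mul_one, mul_zero, add_zero] at this
      exact this.trans hv'
    · obtain ⟨h1, h2⟩ := tan_half_mul_cos (cos_pos θ hθ).ne'
      linear_combination v 0 * h1 + v 1 * h2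
    · obtain ⟨h1, h2⟩ := tan_half_mul_cos (cos_pos γ hγ).ne'
      rw [Real.cos_pi_sub, Real.sin_pi_sub]
      linear_combination -v 0 * h1 + v 1 * h2
  -- The middle gap bound says `(θ + γ)/2 ≥ π/4`, where sine dominates cosine; dividing by both
  -- cosines gives `1 - a * c ≤ a + c`.
  · have hle : Real.cos (θ / 2 + γ / 2) ≤ Real.sin (θ / 2 + γ / 2) := by
      rw [← Real.cos_pi_div_two_sub]
      exact Real.cos_le_cos_of_nonneg_of_le_pi (by linarith [hθ.2, hγ.2])
        (by linarith [hθ.2, hγ.2]) (by linarith)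
    rw [Real.cos_add, Real.sin_add] at hle
    have hc1 := cos_pos θ hθ
    have hc2 := cos_pos γ hγ
    rw [Real.tan_eq_sin_div_cos, Real.tan_eq_sin_div_cos, ← sub_nonneg]
    have : Real.sin (θ / 2) / Real.cos (θ / 2) + Real.sin (γ / 2) / Real.cos (γ / 2) -
        (1 - Real.sin (θ / 2) / Real.cos (θ / 2) * (Real.sin (γ / 2) / Real.cos (γ / 2))) =
        (Real.sin (θ / 2) * Real.cos (γ / 2) + Real.cos (θ / 2) * Real.sin (γ / 2) -
          (Real.cos (θ / 2) * Real.cos (γ / 2) - Real.sin (θ / 2) * Real.sin (γ / 2))) /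
          (Real.cos (θ / 2) * Real.cos (γ / 2)) := by
      field_simp
    rw [this]
    exact div_nonneg (by linarith) (by positivity)

theorem volume_unitBall_comp (s : Seminorm ℝ Plane) {T : Plane →ₗ[ℝ] Plane}
    (hT : LinearMap.det T ≠ 0) :
    volume (unitBall (s.comp T)) =
      ENNReal.ofReal |(LinearMap.det T)⁻¹| * volume (unitBall s) :=
  Measure.addHaar_preimage_linearMap volume hT (unitBall s)

theorem IsJohn.volume_unitBall_le {s : Seminorm ℝ Plane} (hs : IsJohn s) :
    volume (unitBall s) ≤ 4 := by
  obtain ⟨φ, -, hφ⟩ := hs.exists_contact 0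
  have h := (hs.comp_rot φ).volume_unitBall_le_of_contact (by
    rw [Seminorm.comp_apply, rot_dir, add_zero, hφ])
  rwa [volume_unitBall_comp s (by rw [det_rot]; exact one_ne_zero), det_rot, inv_one, abs_one,
    ENNReal.ofReal_one, one_mul] at h

/-! ### Reduction of an arbitrary norm to John position. -/

theorem exists_bounds {s : Seminorm ℝ Plane} (hs : IsNorm s) :
    ∃ k > 0, ∃ K > 0, ∀ v, k * ‖v‖ ≤ s v ∧ s v ≤ K * ‖v‖ := by
  obtain ⟨K, hK, hKs⟩ := Seminorm.bound_of_continuous_normedSpace s (seminorm_continuous s)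
  obtain ⟨u, hu, hmin⟩ := (isCompact_sphere (0 : Plane) 1).exists_isMinOn
    ⟨dir 0, by simp [norm_dir]⟩ (seminorm_continuous s).continuousOn
  have hu1 : ‖u‖ = 1 := by simpa using hu
  refine ⟨s u, lt_of_le_of_ne (apply_nonneg s u) fun h => ?_, K, hK, fun v => ⟨?_, hKs v⟩⟩
  · rw [hs u h.symm, norm_zero] at hu1
    exact zero_ne_one hu1
  · rcases eq_or_ne v 0 with rfl | hv
    · simp
    have hv' : 0 < ‖v‖ := norm_pos_iff.2 hv
    have h1 : s u ≤ s (‖v‖⁻¹ • v) := hmin (by simp [norm_smul, hv'.ne'])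
    rw [map_smul_eq_mul, norm_inv, norm_norm] at h1
    calc s u * ‖v‖ ≤ ‖v‖⁻¹ * s v * ‖v‖ := mul_le_mul_of_nonneg_right h1 hv'.le
      _ = s v := by field_simp

/-- Every norm can be put in John position. -/
theorem exists_isJohn_comp {s : Seminorm ℝ Plane} (hs : IsNorm s) :
    ∃ T : Plane →ₗ[ℝ] Plane, LinearMap.det T ≠ 0 ∧ IsJohn (s.comp T) := by
  obtain ⟨k, hk, K, hK, hb⟩ := exists_bounds hs
  set A : Set (Plane →L[ℝ] Plane) := {T | ∀ v, s (T v) ≤ ‖v‖} with hA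
  have hcl : IsClosed A := by
    rw [hA, Set.ofPred_forall]
    refine isClosed_iInter fun v => isClosed_le ?_ continuous_const
    exact (seminorm_continuous s).comp (ContinuousLinearMap.apply ℝ Plane v).continuous
  have hbd : Bornology.IsBounded A := by
    refine (Metric.isBounded_closedBall (x := (0 : Plane →L[ℝ] Plane)) (r := k⁻¹)).subset ?_
    intro T hT
    rw [mem_closedBall_zero_iff]
    refine T.opNorm_le_bound (by positivity) fun v => ?_
    rw [inv_mul_eq_div, le_div_iff₀ hk, mul_comm]
    exact (hb _).1.trans (hT v)
  have : ProperSpace (Plane →L[ℝ] Plane) := FiniteDimensional.proper ℝ _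
  -- A small disc is an invertible competitor, so the maximal `|det|` over the compact set `A` is
  -- positive.
  have hmem : K⁻¹ • ContinuousLinearMap.id ℝ Plane ∈ A := fun v => by
    refine (hb _).2.trans_eq ?_
    rw [smul_apply, norm_smul, norm_inv, Real.norm_of_nonneg hK.le,
      ContinuousLinearMap.id_apply]
    field_simp
  obtain ⟨T, hT, hmax⟩ := (Metric.isCompact_of_isClosed_isBounded hcl hbd).exists_isMaxOn
    ⟨_, hmem⟩ ContinuousLinearMap.continuous_det.abs.continuousOn
  have hmax' : ∀ S : Plane →ₗ[ℝ] Plane, (∀ v, s (S v) ≤ ‖v‖) →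
      |LinearMap.det S| ≤ |LinearMap.det (T : Plane →ₗ[ℝ] Plane)| := fun S hS =>
    hmax (a := LinearMap.toContinuousLinearMap S) hS
  have hdet : 0 < |LinearMap.det (T : Plane →ₗ[ℝ] Plane)| := by
    refine lt_of_lt_of_le ?_ (hmax' (K⁻¹ • LinearMap.id) hmem)
    rw [LinearMap.det_smul, LinearMap.det_id, mul_one]
    positivity
  refine ⟨T, abs_pos.1 hdet, hT, fun S hS => ?_⟩
  have := hmax' ((T : Plane →ₗ[ℝ] Plane) ∘ₗ S) hS
  rw [LinearMap.det_comp, abs_mul] at this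
  exact (mul_le_iff_le_one_right hdet).1 this

/-- Off-centre ellipses gain nothing: the ball is symmetric and convex, so the recentred ellipse
lies in it too. -/
theorem IsJohn.abs_det_le_of_ellipse_subset {s : Seminorm ℝ Plane} (hs : IsJohn s) {c : Plane}
    {T : Plane →ₗ[ℝ] Plane} (h : ∀ v : Plane, ‖v‖ ≤ 1 → s (c + T v) ≤ 1) :
    |LinearMap.det T| ≤ 1 := by
  refine hs.2 T fun v => ?_
  have unit : ∀ v : Plane, ‖v‖ ≤ 1 → s (T v) ≤ 1 := by
    intro v hv
    have h1 := h v hv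
    have h2 := h (-v) (by rwa [norm_neg])
    have h3 : (2 : ℝ) • T v = (c + T v) - (c + T (-v)) := by
      rw [map_neg, two_smul]; abel
    have h4 := (map_sub_le_add s (c + T v) (c + T (-v)))
    rw [← h3, map_smul_eq_mul, Real.norm_of_nonneg zero_le_two] at h4
    linarith
  rcases eq_or_ne v 0 with rfl | hv
  · simp
  have hv' : 0 < ‖v‖ := norm_pos_iff.2 hv
  have h1 := unit (‖v‖⁻¹ • v) (by rw [norm_smul, norm_inv, norm_norm, inv_mul_cancel₀ hv'.ne'])
  rwa [map_smul, map_smul_eq_mul, norm_inv, norm_norm, inv_mul_le_iff₀ hv', mul_one] at h1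

/-- If `s ∘ T` is in John position, then the image of the disc under `T` is the Loewner ellipse. -/
theorem isLoewnerEllipse_of_isJohn_comp {s : Seminorm ℝ Plane} {T : Plane ≃ₗ[ℝ] Plane}
    (h : IsJohn (s.comp (T : Plane →ₗ[ℝ] Plane))) :
    IsLoewnerEllipse (unitBall s) ((fun v => (0 : Plane) + T v) '' Metric.closedBall 0 1) := by
  refine ⟨⟨0, T, rfl⟩, ?_, ?_⟩
  · rintro _ ⟨v, hv, rfl⟩
    rw [mem_closedBall_zero_iff] at hv
    simp only [zero_add]
    exact (h.1 v).trans hv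
  · rintro _ ⟨c, S, rfl⟩ hE
    have h1 := area_ellipse c (S : Plane →ₗ[ℝ] Plane)
    have h2 := area_ellipse 0 (T : Plane →ₗ[ℝ] Plane)
    simp only [LinearEquiv.coe_coe] at h1 h2
    rw [h1, h2]
    refine mul_le_mul_of_nonneg_right ?_ Real.pi_nonneg
    have h3 : |LinearMap.det ((T.symm : Plane →ₗ[ℝ] Plane) ∘ₗ (S : Plane →ₗ[ℝ] Plane))| ≤ 1 := by
      refine h.abs_det_le_of_ellipse_subset (c := T.symm c) fun v hv => ?_
      have hw := hE ⟨v, mem_closedBall_zero_iff.2 hv, rfl⟩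
      simpa [unitBall] using hw
    have h4 : (S : Plane →ₗ[ℝ] Plane) = (T : Plane →ₗ[ℝ] Plane) ∘ₗ
        ((T.symm : Plane →ₗ[ℝ] Plane) ∘ₗ (S : Plane →ₗ[ℝ] Plane)) := by
      ext v
      simp
    rw [h4, LinearMap.det_comp, abs_mul]
    exact mul_le_of_le_one_right (abs_nonneg _) h3

theorem area_unitBall_pos {s : Seminorm ℝ Plane} (hs : IsNorm s) : 0 < area (unitBall s) := by
  obtain ⟨k, hk, K, hK, hb⟩ := exists_bounds hs
  refine ENNReal.toReal_pos (ne_of_gt ?_) (ne_of_lt ?_)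
  · refine (Metric.measure_closedBall_pos volume (0 : Plane) (inv_pos.2 hK)).trans_le
      (measure_mono fun v hv => (hb v).2.trans ?_)
    rw [mem_closedBall_zero_iff, ← one_div, le_div_iff₀ hK] at hv
    rwa [mul_comm]
  · refine (measure_mono fun v hv => ?_).trans_lt
      (measure_closedBall_lt_top (x := (0 : Plane)) (r := k⁻¹))
    rw [mem_closedBall_zero_iff, ← one_div, le_div_iff₀ hk, mul_comm]
    exact (hb v).1.trans hv

/-- Both areas scale by `|det T|` on passing to John position, where they are `π` and at most `4`.
-/
theorem le_ratio {s : Seminorm ℝ Plane} (hs : IsNorm s) :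
    Real.pi / 4 ≤ area (loewnerEllipse (unitBall s)) / area (unitBall s) := by
  obtain ⟨T, hT, hJ⟩ := exists_isJohn_comp hs
  let T' : Plane ≃ₗ[ℝ] Plane := LinearMap.equivOfDetNeZero T hT
  have hTT : (T' : Plane →ₗ[ℝ] Plane) = T := by ext; rfl
  have hL := isLoewnerEllipse_of_isJohn_comp (T := T') (by rwa [hTT])
  have h2 := area_ellipse 0 (T' : Plane →ₗ[ℝ] Plane)
  simp only [LinearEquiv.coe_coe] at h2
  have hd : 0 < |LinearMap.det T| := abs_pos.2 hT
  have hv := ENNReal.toReal_mono (by norm_num) hJ.volume_unitBall_le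
  rw [volume_unitBall_comp s hT, ENNReal.toReal_mul, ENNReal.toReal_ofReal (abs_nonneg _), abs_inv,
    inv_mul_le_iff₀ hd] at hv
  have hv' : area (unitBall s) ≤ |LinearMap.det T| * 4 := by simpa [area] using hv
  rw [hL.area_loewnerEllipse, h2, hTT, div_le_div_iff₀ (by norm_num) (area_unitBall_pos hs)]
  nlinarith [mul_le_mul_of_nonneg_left hv' Real.pi_nonneg]

end NormedPlane

theorem lemma2p3 :
    NormedPlane.q NormedPlane.busemannJacobian = Real.pi / 4 ∧
    IsLeast (NormedPlane.jacobianRatios NormedPlane.busemannJacobian) (Real.pi / 4) ∧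
    ∀ s : Seminorm ℝ NormedPlane.Plane, NormedPlane.IsNorm s →
      NormedPlane.IsSquareRegion (NormedPlane.unitBall s) →
      NormedPlane.busemannJacobian s / NormedPlane.inscribedJacobian s = Real.pi / 4 := by
  have hsq : ∀ s : Seminorm ℝ NormedPlane.Plane, NormedPlane.IsNorm s →
      NormedPlane.IsSquareRegion (NormedPlane.unitBall s) →
      NormedPlane.busemannJacobian s / NormedPlane.inscribedJacobian s = Real.pi / 4 :=
    fun s hs h => (NormedPlane.ratio_eq hs).trans h.ratio
  have hleast : IsLeast (NormedPlane.jacobianRatios NormedPlane.busemannJacobian)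
      (Real.pi / 4) := by
    refine ⟨⟨NormedPlane.supNorm, NormedPlane.isNorm_supNorm,
      (hsq _ NormedPlane.isNorm_supNorm NormedPlane.isSquareRegion_unitBall_supNorm).symm⟩, ?_⟩
    rintro r ⟨s, hs, rfl⟩
    rw [NormedPlane.ratio_eq hs]
    exact NormedPlane.le_ratio hs
  exact ⟨hleast.csInf_eq, hleast, hsq⟩
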